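/- A server holds a library of $N$ files of $B$ bits each, and there are $\Lambda$ caches of $MB$ bits each and $K\le N$ users; fix $\lambda\in\{1,\dots,\Lambda\}$. A connectivity $b$ is a vector of non-negative integers $(K_{\mathcal U,b})_{\mathcal U\subseteq\{1,\dots,\Lambda\}}$, where $K_{\mathcal U,b}$ is the number of users connected exactly to the caches in $\mathcal U$, with $\sum_{\mathcal U}K_{\mathcal U,b}=K$. Let $\mathcal B_\lambda$ be the set of all connectivities with $K_{\mathcal U,b}=0$ whenever $|\mathcal U|\ne\lambda$, i.e. each user is connected to exactly $\lambda$ caches. Then $|\mathcal B_\lambda|=\binom{K+\binom{\Lambda}{\lambda}-1}{K}$. A placement is uncoded if each cache stores a copy of at most $MB$ bits of the library; it is chosen once, before the connectivity and the demands are known. For a given placement and connectivity $b$, a load $R_b$ is feasible if, for every demand vector (each user requesting one file), the server can broadcast $R_bB$ bits, computed from the library with knowledge of the placement, of $b$ and of the demands, from which, together with the contents of the caches that it is connected to, every user recovers its requested file without error, for all possible contents of the library. The optimal average worst-case load $R^\star_{\mathrm{avg},\mathcal B_\lambda}(M)$ is the infimum, over all $B\ge 1$, all uncoded placements that are the same for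 all $b\in\mathcal B_\lambda$, and all feasible loads $(R_b)_{b\in\mathcal B_\lambda}$, of $\frac{1}{|\mathcal B_\lambda|}\sum_{b\in\mathcal B_\lambda}R_b$ (all connectivities in $\mathcal B_\lambda$ are equiprobable). Theorem. For all integers $\Lambda\ge\lambda\ge1$ and $N\ge K\ge 0$, and for every $M\in\left[0,\frac{(\Lambda-\lambda+1)N}{\Lambda}\right]$, the load $R^\star_{\mathrm{avg},\mathcal B_\lambda}(M)$ is at least the value at $M$ of the piecewise linear curve with corner points $$\left(t\,\frac{N}{\Lambda},\ \frac{K\binom{\Lambda}{t+\lambda}}{\binom{\Lambda}{\lambda}\binom{\Lambda}{t}}+A_t\right),\qquad t=0,1,\dots,\Lambda-\lambda+1,$$ where $$A_t=\frac{K}{|\mathcal B_\lambda|}\binom{\Lambda-t}{\lambda}\left(1-\frac{1}{\binom{t+\lambda}{\lambda}}\right)$$ and $\binom{n}{k}=0$ for $n<k$. -/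

import Mathlib

namespace MACC

/-- The content of the library: `N` files of `B` bits each. -/
abbrev Library (N B : ℕ) := Fin N → Fin B → Bool

/-- The ensemble of all connectivities with `Λ` caches and `K` users in which every user is connected
to exactly `lam` caches. A connectivity is the vector `b` of multiplicities: `b U` is the number of
users connected exactly to the caches in `U`. -/
def ensemble (Λ K lam : ℕ) : Finset (Finset (Fin Λ) → ℕ) :=
  Finset.piAntidiag (Finset.powersetCard lam Finset.univ) K

theorem mem_ensemble {Λ K lam : ℕ} {b : Finset (Fin Λ) → ℕ} :
    b ∈ ensemble Λ K lam ↔ ∑ U, b U = K ∧ ∀ U, b U ≠ 0 → U.card = lam := by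
  rw [ensemble, Finset.mem_piAntidiag]
  simp only [Finset.mem_powersetCard, Finset.subset_univ, true_and]
  refine and_congr_left fun h => ?_
  rw [Finset.sum_subset (Finset.subset_univ _)]
  intro U _ hU
  by_contra hne
  exact hU (Finset.mem_powersetCard.2 ⟨Finset.subset_univ _, h U hne⟩)

/-- The users under the connectivity `b`: `⟨U, k⟩` is the `k`-th user connected exactly to the caches
in `U`. -/
abbrev User {Λ : ℕ} (b : Finset (Fin Λ) → ℕ) := Σ U : Finset (Fin Λ), Fin (b U)

/-- An uncoded cache placement: cache `ℓ` stores a copy of the library bits whose positions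
(file, index in the file) lie in `Z ℓ`. -/
abbrev Placement (Λ N B : ℕ) := Fin Λ → Finset (Fin N × Fin B)

/-- Every cache has size `M * B` bits. -/
def Placement.Fits {Λ N B : ℕ} (Z : Placement Λ N B) (M : ℝ) : Prop :=
  ∀ ℓ, ((Z ℓ).card : ℝ) ≤ M * B

/-- The possible contents of the caches in `U`. -/
abbrev CacheContents {Λ N B : ℕ} (Z : Placement Λ N B) (U : Finset (Fin Λ)) :=
  (ℓ : U) → (Z ℓ → Bool)

/-- The contents of the caches in `U` when the library is `W`. -/
def cacheContents {Λ N B : ℕ} (Z : Placement Λ N B) (U : Finset (Fin Λ)) (W : Library N B) :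
    CacheContents Z U :=
  fun _ p => W p.1.1 p.1.2

/-- Under placement `Z` and connectivity `b`, the server can satisfy the demand `d` (user `u` requests
file `d u`) by broadcasting `L` bits: each user recovers its file, whatever the library is, from
the broadcast and from the caches it is connected to. -/
def Serves {Λ N B : ℕ} (Z : Placement Λ N B) (b : Finset (Fin Λ) → ℕ) (L : ℕ)
    (d : User b → Fin N) : Prop :=
  ∃ (enc : Library N B → (Fin L → Bool))
    (dec : (u : User b) → (Fin L → Bool) → CacheContents Z u.1 → (Fin B → Bool)),
    ∀ (W : Library N B) (u : User b), dec u (enc W) (cacheContents Z u.1 W) = W (d u)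

/-- `(M, R)` is achievable: for some file size `B` there are one uncoded placement `Z` with caches of
`M * B` bits, fixed for the whole ensemble, and for each connectivity `b` a number `L b` of
broadcast bits that suffices for every demand, such that the average of `L b / B` over the
(equiprobable) connectivities is at most `R`. -/
def Achievable (Λ N K lam : ℕ) (M R : ℝ) : Prop :=
  ∃ (B : ℕ) (_ : 0 < B) (Z : Placement Λ N B) (L : (Finset (Fin Λ) → ℕ) → ℕ),
    Z.Fits M ∧
    (∀ b ∈ ensemble Λ K lam, ∀ d : User b → Fin N, Serves Z b (L b) d) ∧
    (∑ b ∈ ensemble Λ K lam, (L b : ℝ) / B) / (ensemble Λ K lam).card ≤ R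

/-- The optimal average worst-case load over the ensemble, under fixed uncoded placement. -/
noncomputable def optAvgLoad (Λ N K lam : ℕ) (M : ℝ) : ℝ :=
  sInf {R | Achievable Λ N K lam M R}

/-- The infimum in `optAvgLoad` is over a set that is bounded below. -/
theorem bddBelow_achievable (Λ N K lam : ℕ) (M : ℝ) :
    BddBelow {R | Achievable Λ N K lam M R} := by
  refine ⟨0, ?_⟩
  rintro R ⟨B, _, Z, L, _, _, h⟩
  exact le_trans (by positivity) h

/-- The infimum in `optAvgLoad` is over a nonempty set: the server can broadcast the library. -/
theorem achievable_nonempty (Λ N K lam : ℕ) {M : ℝ} (hM : 0 ≤ M) :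
    {R | Achievable Λ N K lam M R}.Nonempty := by
  refine ⟨_, 1, one_pos, fun _ => ∅, fun _ => N, fun _ => by simpa using hM, ?_, le_rfl⟩
  intro b _ d
  exact ⟨fun W n => W n 0, fun u x _ _ => x (d u), fun W u => by
    funext i; rw [Subsingleton.elim i 0]⟩

/-- The number `A_t`. -/
noncomputable def extraLoad (Λ K lam t : ℕ) : ℝ :=
  (K : ℝ) / (ensemble Λ K lam).card * ((Λ - t).choose lam) *
    (1 - 1 / ((t + lam).choose lam : ℝ))

/-- The corner point (memory, load) with index `t` of the lower bound. -/
noncomputable def cornerPoint (Λ N K lam t : ℕ) : ℝ × ℝ :=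
  ((t : ℝ) * N / Λ,
    (K : ℝ) * (Λ.choose (t + lam)) / ((Λ.choose lam : ℝ) * (Λ.choose t)) + extraLoad Λ K lam t)

/-- The piecewise linear curve with the corner points of index `t = 0, …, Λ - lam + 1`: the union of
the segments that join consecutive corner points. -/
def lowerBoundCurve (Λ N K lam : ℕ) : Set (ℝ × ℝ) :=
  {p | ∃ t : ℕ, t + lam ≤ Λ ∧
    p ∈ segment ℝ (cornerPoint Λ N K lam t) (cornerPoint Λ N K lam (t + 1))}

end MACC

namespace MACC

open Finset

/-! Give users with distinct requests ranks, and credit each user with the bits of its file outside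
a set of caches that includes every cache seen at its rank or below. Decoding in rank order shows
that the broadcast determines all credited bits (`Serves.sum_card_le`).

Ranking users by the last of their caches in a random order of the caches, a bit with `t` holders is
credited to a user whose `lam` caches miss the holders with probability at least `1 / (t +
lam).choose lam` (`sum_div_choose_le`). If all users share the same caches, no order is needed and
the credit is certain (`sum_le_of_concentrated`). The surplus in these concentrated connectivities
is `extraLoad`.

Summed over the ensemble, a bit with `t` holders contributes the corner load of index `t`
(`sum_cornerPoint_le`). These loads are nonincreasing and convex in `t`, and the cache sizes bound
the mean of `t` by `Λ * M / N`, so a supporting line gives the curve. -/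

theorem card_ensemble (Λ K lam : ℕ) :
    (ensemble Λ K lam).card = (K + Λ.choose lam - 1).choose K := by
  have h := Finset.card_finsuppAntidiag_nat_eq_choose
    (s := powersetCard lam (univ : Finset (Fin Λ))) K
  rw [card_powersetCard, card_univ, Fintype.card_fin, add_comm] at h
  rw [ensemble, ← h, finsuppAntidiag, card_map, card_attach]

/-! ### The acyclic converse bound. -/

/-- The acyclic converse bound: if the broadcast serves a demand for distinct files, then it carries
all bits of these files that are not stored in the caches of `C u`, provided that whoever sees
a cache outside `C u` has a larger rank than `u`. -/
theorem Serves.sum_card_le {Λ N B L : ℕ} {Z : Placement Λ N B} {b : Finset (Fin Λ) → ℕ}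
    {d : User b → Fin N} (h : Serves Z b L d) (hd : Function.Injective d)
    (C : User b → Finset (Fin Λ)) (r : User b → ℕ)
    (hr : ∀ u v : User b, ∀ ℓ ∈ v.1, ℓ ∉ C u → r u < r v) :
    ∑ u, #{j : Fin B | ∀ ℓ ∈ C u, (d u, j) ∉ Z ℓ} ≤ L := by
  classical
  obtain ⟨enc, dec, hdec⟩ := h
  set D : User b → Finset (Fin B) := fun u => {j | ∀ ℓ ∈ C u, (d u, j) ∉ Z ℓ} with hD
  set S : Finset (Fin N × Fin B) :=
    ((univ : Finset (User b)).sigma D).image fun x => (d x.1, x.2) with hS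
  have hSmem : ∀ p, p ∈ S ↔ ∃ u, d u = p.1 ∧ p.2 ∈ D u := by
    rintro ⟨n, j⟩
    simp only [hS, mem_image, mem_sigma, mem_univ, true_and, Prod.mk.injEq]
    constructor
    · rintro ⟨x, hx, h1, rfl⟩
      exact ⟨x.1, h1, hx⟩
    · rintro ⟨u, h1, h2⟩
      exact ⟨⟨u, j⟩, h2, h1, rfl⟩
  have hcard : S.card = ∑ u, (D u).card := by
    rw [hS, card_image_of_injective, card_sigma]
    rintro ⟨u, j⟩ ⟨v, k⟩ hx
    obtain ⟨h1, h2⟩ := Prod.mk.inj hx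
    obtain rfl := hd h1
    obtain rfl : j = k := h2
    rfl
  let lib : Finset (Fin N × Fin B) → Library N B := fun s n j => decide ((n, j) ∈ s)
  -- Libraries that vanish off `S` need distinct broadcasts, so `2 ^ #S ≤ 2 ^ L`.
  have hinj : Set.InjOn (fun s => enc (lib s)) (S.powerset : Set (Finset (Fin N × Fin B))) := by
    intro s hs s' hs' he
    simp only [coe_powerset, Set.mem_preimage, Set.mem_powerset_iff, coe_subset] at hs hs'
    -- Induction on rank: a cached bit seen by `u` is either off `S`, hence zero in both libraries,
    -- or in the file of a user of smaller rank, already known to agree.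
    have key : ∀ k u, r u < k → lib s (d u) = lib s' (d u) := by
      intro k
      induction k with
      | zero => intro u hu; omega
      | succ k ih =>
        intro u hu
        rw [← hdec (lib s) u, ← hdec (lib s') u]
        have hc : cacheContents Z u.1 (lib s) = cacheContents Z u.1 (lib s') := by
          funext ℓ p
          obtain ⟨p, hp⟩ := p
          by_cases hpS : p ∈ S
          · obtain ⟨v, hv, hv'⟩ := (hSmem p).1 hpS
            have hv2 : ∀ ℓ ∈ C v, (d v, p.2) ∉ Z ℓ := (mem_filter.1 hv').2
            rw [hv] at hv2
            have hlt : r v < r u := hr v u ℓ ℓ.2 fun hℓ => hv2 _ hℓ hp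
            have := ih v (by omega)
            rw [hv] at this
            exact congrFun this p.2
          · have h1 : p ∉ s := fun h => hpS (hs h)
            have h2 : p ∉ s' := fun h => hpS (hs' h)
            simp [cacheContents, lib, h1, h2]
        have he' : enc (lib s) = enc (lib s') := he
        rw [hc, he']
    have hmem : ∀ p ∈ S, (p ∈ s ↔ p ∈ s') := by
      intro p hp
      obtain ⟨v, hv, -⟩ := (hSmem p).1 hp
      have h1 := congrFun (key _ v (Nat.lt_succ_self _)) p.2
      rw [hv] at h1
      simpa [lib] using h1
    ext p
    exact ⟨fun hp => (hmem p (hs hp)).1 hp, fun hp => (hmem p (hs' hp)).2 hp⟩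
  have hle := card_le_card_of_injOn (t := (univ : Finset (Fin L → Bool)))
    (fun s => enc (lib s)) (fun _ _ => mem_coe.2 (mem_univ _)) hinj
  rw [card_powerset, card_univ, Fintype.card_fun, Fintype.card_bool, Fintype.card_fin] at hle
  rw [← hcard]
  exact (Nat.pow_le_pow_iff_right (by norm_num)).1 hle

/-- The acyclic bound, averaged over the cyclic shifts of a demand for distinct files. -/
theorem sum_card_users_le {Λ N B L : ℕ} {Z : Placement Λ N B} {b : Finset (Fin Λ) → ℕ}
    (hb : ∑ U, b U ≤ N) (h : ∀ d : User b → Fin N, Serves Z b L d)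
    (C : User b → Finset (Fin Λ)) (r : User b → ℕ)
    (hr : ∀ u v : User b, ∀ ℓ ∈ v.1, ℓ ∉ C u → r u < r v) :
    ∑ p : Fin N × Fin B, #{u : User b | ∀ ℓ ∈ C u, p ∉ Z ℓ} ≤ N * L := by
  obtain _ | n := N
  · simp
  obtain ⟨e⟩ : Nonempty (User b ↪ Fin (n + 1)) := by
    apply Function.Embedding.nonempty_of_card_le
    simpa [Fintype.card_sigma] using hb
  -- As `s` varies, each user requests every file exactly once.
  have h1 : ∑ s : Fin (n + 1), ∑ u, #{j : Fin B | ∀ ℓ ∈ C u, (e u + s, j) ∉ Z ℓ} ≤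
      ∑ _s : Fin (n + 1), L :=
    sum_le_sum fun s _ => (h fun u => e u + s).sum_card_le
      (fun u v huv => e.injective (add_right_cancel huv)) C r hr
  rw [sum_const, card_univ, Fintype.card_fin, smul_eq_mul] at h1
  refine le_of_eq_of_le ?_ h1
  simp only [card_filter]
  rw [sum_comm, sum_comm (s := (univ : Finset (Fin (n + 1))))]
  refine sum_congr rfl fun u _ => ?_
  rw [Fintype.sum_prod_type]
  exact (Equiv.sum_comp (Equiv.addLeft (e u))
    fun s => ∑ j : Fin B, if ∀ ℓ ∈ C u, (s, j) ∉ Z ℓ then 1 else 0).symm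

theorem card_filter_user {Λ : ℕ} (b : Finset (Fin Λ) → ℕ) (P : Finset (Fin Λ) → Prop)
    [DecidablePred P] : #{u : User b | P u.1} = ∑ U, if P U then b U else 0 := by
  rw [card_filter, Fintype.sum_sigma]
  refine sum_congr rfl fun U _ => ?_
  split_ifs <;> simp

/-! ### Random orders of the caches. -/

/-- A set `X` has a subset of any size `k ≤ #X` that precedes its complement in `X` for `f`. -/
theorem exists_initial_subset {α : Type*} [DecidableEq α] {β : Type*} [LinearOrder β] (f : α → β)
    (hf : Function.Injective f) (X : Finset α) (k : ℕ) (hk : k ≤ #X) :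
    ∃ V ∈ powersetCard k X, ∀ v ∈ V, ∀ w ∈ X \ V, f v < f w := by
  induction k with
  | zero => exact ⟨∅, by simp⟩
  | succ k ih =>
    obtain ⟨V, hV, hlt⟩ := ih (by omega)
    obtain ⟨hVX, hVk⟩ := mem_powersetCard.1 hV
    have hne : (X \ V).Nonempty := by
      rw [← card_pos, card_sdiff_of_subset hVX]; omega
    obtain ⟨x, hx, hmin⟩ := exists_min_image (X \ V) f hne
    obtain ⟨hxX, hxV⟩ := mem_sdiff.1 hx
    refine ⟨insert x V, mem_powersetCard.2 ⟨insert_subset hxX hVX, ?_⟩, ?_⟩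
    · rw [card_insert_of_notMem hxV, hVk]
    · intro v hv w hw
      obtain ⟨hwX, hw'⟩ := mem_sdiff.1 hw
      rw [mem_insert, not_or] at hw'
      have hwV : w ∈ X \ V := mem_sdiff.2 ⟨hwX, hw'.2⟩
      obtain rfl | hv := mem_insert.1 hv
      · exact lt_of_le_of_ne (hmin w hwV) fun h => hw'.1 (hf h).symm
      · exact hlt v hv w hwV

theorem exists_perm_image {α : Type*} [Fintype α] [DecidableEq α] {X U V : Finset α}
    (hU : U ⊆ X) (hV : V ⊆ X) (h : #U = #V) :
    ∃ g : Equiv.Perm α, (∀ x, g x ∈ X ↔ x ∈ X) ∧ ∀ x, g x ∈ V ↔ x ∈ U := by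
  have e1 : Nonempty ({x : X // x.1 ∈ U} ≃ {x : X // x.1 ∈ V}) := by
    refine ⟨Fintype.equivOfCardEq ?_⟩
    rw [Fintype.card_subtype, Fintype.card_subtype]
    have aux : ∀ W ⊆ X, #{x : X | x.1 ∈ W} = #W := by
      intro W hW
      refine card_bij (fun x _ => x.1) (fun x hx => (mem_filter.1 hx).2)
        (fun x _ y _ hxy => Subtype.ext hxy) fun y hy => ⟨⟨y, hW hy⟩, by simpa using hy, rfl⟩
    rw [aux U hU, aux V hV, h]
  obtain ⟨e⟩ := e1
  refine ⟨Equiv.Perm.ofSubtype e.extendSubtype, ?_, ?_⟩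
  · intro x
    by_cases hx : x ∈ X
    · simp [Equiv.Perm.ofSubtype_apply_of_mem _ hx, hx]
    · rw [Equiv.Perm.ofSubtype_apply_of_not_mem _ hx]
  · intro x
    by_cases hx : x ∈ X
    · rw [Equiv.Perm.ofSubtype_apply_of_mem _ hx]
      by_cases hxU : x ∈ U
      · exact iff_of_true (e.extendSubtype_mem ⟨x, hx⟩ hxU) hxU
      · exact iff_of_false (e.extendSubtype_not_mem ⟨x, hx⟩ hxU) hxU
    · rw [Equiv.Perm.ofSubtype_apply_of_not_mem _ hx]
      exact iff_of_false (fun h => hx (hV h)) fun h => hx (hU h)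

/-- A uniformly random order puts all of `U` before all of `T` with probability at least
`1 / (#T + #U).choose #U`. -/
theorem factorial_le_choose_mul_card_perm {n : ℕ} {T U : Finset (Fin n)} (h : Disjoint T U) :
    n.factorial ≤ (#T + #U).choose #U *
      #{σ : Equiv.Perm (Fin n) | ∀ m ∈ U, ∀ ℓ ∈ T, σ m < σ ℓ} := by
  set X := T ∪ U with hX
  have hXc : #X = #T + #U := card_union_of_disjoint h
  have hUX : U ⊆ X := subset_union_right
  have hXU : X \ U = T := by rw [hX, union_sdiff_right, sdiff_eq_self_of_disjoint h]
  let A : Finset (Fin n) → Finset (Equiv.Perm (Fin n)) :=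
    fun V => {σ | ∀ v ∈ V, ∀ w ∈ X \ V, σ v < σ w}
  have hcov : (univ : Finset (Equiv.Perm (Fin n))) ⊆ (powersetCard #U X).biUnion A := by
    intro σ _
    obtain ⟨V, hV, hlt⟩ := exists_initial_subset σ σ.injective X #U (by omega)
    exact mem_biUnion.2 ⟨V, hV, mem_filter.2 ⟨mem_univ _, hlt⟩⟩
  -- Relabelling by a permutation that preserves `X` and carries `U` to `V` turns orders with `V`
  -- first into orders with `U` first; the sets `A V` cover all orders.
  have hA : ∀ V ∈ powersetCard #U X, #(A V) ≤ #(A U) := by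
    intro V hV
    obtain ⟨hVX, hVc⟩ := mem_powersetCard.1 hV
    obtain ⟨g, hgX, hgV⟩ := exists_perm_image hUX hVX hVc.symm
    refine card_le_card_of_injOn (fun σ => σ * g) ?_ ((mul_left_injective g).injOn)
    intro σ hσ
    have hσ' := (mem_filter.1 hσ).2
    refine mem_coe.2 (mem_filter.2 ⟨mem_univ _, fun v hv w hw => ?_⟩)
    obtain ⟨hwX, hwU⟩ := mem_sdiff.1 hw
    exact hσ' (g v) ((hgV v).2 hv) (g w)
      (mem_sdiff.2 ⟨(hgX w).2 hwX, fun h => hwU ((hgV w).1 h)⟩)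
  have h1 := (card_le_card hcov).trans (card_biUnion_le_card_mul _ _ _ hA)
  rw [card_univ, Fintype.card_perm, Fintype.card_fin, card_powersetCard, hXc] at h1
  simpa only [A, hXU] using h1

/-! ### Load bounds for a single connectivity. -/

/-- The caches that store the library bit at position `p`. -/
def holders {Λ N B : ℕ} (Z : Placement Λ N B) (p : Fin N × Fin B) : Finset (Fin Λ) :=
  {ℓ | p ∈ Z ℓ}

theorem mem_holders {Λ N B : ℕ} {Z : Placement Λ N B} {p : Fin N × Fin B} {ℓ : Fin Λ} :
    ℓ ∈ holders Z p ↔ p ∈ Z ℓ := by simp [holders]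

/-- The bound for an arbitrary connectivity, averaged over the orders of the caches. -/
theorem sum_div_choose_le {Λ N B L : ℕ} {Z : Placement Λ N B} {b : Finset (Fin Λ) → ℕ}
    (hb : ∑ U, b U ≤ N) (h : ∀ d : User b → Fin N, Serves Z b L d) :
    ∑ p : Fin N × Fin B, ∑ U, (if Disjoint (holders Z p) U then
      (b U : ℝ) / ((#(holders Z p) + #U).choose #U : ℝ) else 0) ≤ N * L := by
  classical
  have hσ : ∀ σ : Equiv.Perm (Fin Λ), ∑ p : Fin N × Fin B, ∑ U,
      (if ∀ m ∈ U, ∀ ℓ ∈ holders Z p, σ m < σ ℓ then b U else 0) ≤ N * L := by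
    intro σ
    refine le_of_eq_of_le (sum_congr rfl fun p _ => ?_) (sum_card_users_le hb h
      -- The set consists of the caches up to the last one of `u`, whose position is the rank. The
      -- `+ 1` separates a user without caches from one whose only cache comes first.
      (fun u => {ℓ | ∃ m ∈ u.1, σ ℓ ≤ σ m}) (fun u => u.1.sup fun m => (σ m : ℕ) + 1) ?_)
    · rw [← card_filter_user b fun U => ∀ m ∈ U, ∀ ℓ ∈ holders Z p, σ m < σ ℓ]
      congr 1
      refine filter_congr fun u _ => ?_
      simp only [mem_holders, mem_filter, mem_univ, true_and, forall_exists_index, and_imp]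
      constructor
      · intro H ℓ m hm hle hp
        exact absurd (H m hm ℓ hp) (not_lt.2 hle)
      · intro H m hm ℓ hp
        by_contra hlt
        exact H ℓ m hm (not_lt.1 hlt) hp
    · intro u v ℓ hℓ hn
      simp only [mem_filter, mem_univ, true_and, not_exists, not_and, not_le] at hn
      have h1 : (σ ℓ : ℕ) + 1 ≤ v.1.sup fun m => (σ m : ℕ) + 1 :=
        le_sup (f := fun m => (σ m : ℕ) + 1) hℓ
      have h2 : (u.1.sup fun m => (σ m : ℕ) + 1) ≤ (σ ℓ : ℕ) :=
        Finset.sup_le fun m hm => hn m hm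
      omega
  have hsum := sum_le_sum fun (σ : Equiv.Perm (Fin Λ)) (_ : σ ∈ univ) => hσ σ
  rw [sum_const, card_univ, Fintype.card_perm, Fintype.card_fin, smul_eq_mul, sum_comm] at hsum
  have hfac : (0 : ℝ) < (Λ.factorial : ℝ) := by exact_mod_cast Λ.factorial_pos
  refine le_of_mul_le_mul_left ?_ hfac
  refine le_trans ?_ (by exact_mod_cast hsum : ((∑ p : Fin N × Fin B, ∑ σ : Equiv.Perm (Fin Λ),
    ∑ U, (if ∀ m ∈ U, ∀ ℓ ∈ holders Z p, σ m < σ ℓ then b U else 0) : ℕ) : ℝ) ≤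
      Λ.factorial * (N * L))
  rw [mul_sum, Nat.cast_sum]
  refine sum_le_sum fun p _ => ?_
  rw [sum_comm, mul_sum, Nat.cast_sum]
  refine sum_le_sum fun U _ => ?_
  split_ifs with hd
  · have hf : (Λ.factorial : ℝ) ≤ ((#(holders Z p) + #U).choose #U : ℝ) *
        #{σ : Equiv.Perm (Fin Λ) | ∀ m ∈ U, ∀ ℓ ∈ holders Z p, σ m < σ ℓ} := by
      exact_mod_cast factorial_le_choose_mul_card_perm hd
    have hc : (0 : ℝ) < ((#(holders Z p) + #U).choose #U : ℝ) := by
      exact_mod_cast Nat.choose_pos (Nat.le_add_left _ _)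
    rw [← sum_filter, sum_const, smul_eq_mul, Nat.cast_mul, ← mul_div_assoc, div_le_iff₀ hc]
    nlinarith [mul_le_mul_of_nonneg_right hf (Nat.cast_nonneg (α := ℝ) (b U))]
  · rw [mul_zero]
    exact Nat.cast_nonneg _

/-- The bound for a connectivity in which all users are connected to the same caches. -/
theorem sum_le_of_concentrated {Λ N B L K : ℕ} {Z : Placement Λ N B} (U : Finset (Fin Λ))
    (hK : K ≤ N) (h : ∀ d : User (Pi.single U K) → Fin N, Serves Z (Pi.single U K) L d) :
    ∑ p : Fin N × Fin B, (if Disjoint (holders Z p) U then (K : ℝ) else 0) ≤ N * L := by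
  classical
  have hsum : ∑ V, (Pi.single U K : Finset (Fin Λ) → ℕ) V = K := by simp
  -- No user sees a cache outside `U`, so the rank condition is vacuous.
  have h1 := sum_card_users_le (hsum.trans_le hK) h (fun _ => U) (fun _ => 0) (by
    rintro u ⟨V, i⟩ ℓ hℓ hn
    have hV : V = U := by
      by_contra hne
      have : (Pi.single U K : Finset (Fin Λ) → ℕ) V = 0 := Pi.single_eq_of_ne hne _
      exact absurd i.2 (by omega)
    subst hV
    exact absurd hℓ hn)
  refine le_trans (le_of_eq ?_) (by exact_mod_cast h1 : ((∑ p : Fin N × Fin B,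
    #{_u : User (Pi.single U K) | ∀ ℓ ∈ U, p ∉ Z ℓ} : ℕ) : ℝ) ≤ N * L)
  rw [Nat.cast_sum]
  refine sum_congr rfl fun p _ => ?_
  have hiff : Disjoint (holders Z p) U ↔ ∀ ℓ ∈ U, p ∉ Z ℓ := by
    rw [disjoint_comm, disjoint_left]; simp [mem_holders]
  by_cases hd : Disjoint (holders Z p) U
  · rw [if_pos hd, filter_true_of_mem fun _ _ => hiff.1 hd, card_univ, Fintype.card_sigma]
    simp
  · rw [if_neg hd, filter_false_of_mem fun _ _ => fun H => hd (hiff.2 H)]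
    simp



/-! ### Averaging over the ensemble. -/

/-- Swapping two `lam`-sets permutes the ensemble, so all of them carry the same total number of
users. -/
theorem sum_ensemble_apply {Λ K lam : ℕ} {U : Finset (Fin Λ)} (hU : #U = lam) :
    (Λ.choose lam) * ∑ b ∈ ensemble Λ K lam, b U = K * #(ensemble Λ K lam) := by
  have hsymm : ∀ V ∈ powersetCard lam (univ : Finset (Fin Λ)),
      ∑ b ∈ ensemble Λ K lam, b V = ∑ b ∈ ensemble Λ K lam, b U := by
    intro V hV
    have hVc := (mem_powersetCard.1 hV).2
    have hmem : ∀ b ∈ ensemble Λ K lam, b ∘ Equiv.swap U V ∈ ensemble Λ K lam := by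
      intro b hb
      obtain ⟨h1, h2⟩ := mem_ensemble.1 hb
      refine mem_ensemble.2 ⟨(Equiv.sum_comp (Equiv.swap U V) b).trans h1, fun W hW => ?_⟩
      have := h2 _ hW
      rw [Equiv.swap_apply_def] at this
      split_ifs at this with h3 h4
      · rw [h3, hU]
      · rw [h4, hVc]
      · exact this
    refine sum_bij' (fun b _ => b ∘ Equiv.swap U V) (fun b _ => b ∘ Equiv.swap U V)
      hmem hmem ?_ ?_ ?_
    · intro b _; funext W; simp
    · intro b _; funext W; simp
    · intro b _; simp
  have h1 := sum_congr rfl hsymm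
  rw [sum_const, card_powersetCard, card_univ, Fintype.card_fin, smul_eq_mul, sum_comm] at h1
  rw [← h1, mul_comm, ← smul_eq_mul, ← sum_const]
  exact sum_congr rfl fun b hb => (mem_piAntidiag.1 hb).1

theorem single_mem_ensemble {Λ K lam : ℕ} {U : Finset (Fin Λ)} (hU : #U = lam) :
    Pi.single U K ∈ ensemble Λ K lam := by
  refine mem_ensemble.2 ⟨by simp, fun V hV => ?_⟩
  by_cases h : V = U
  · rw [h, hU]
  · exact absurd (Pi.single_eq_of_ne h _) hV

theorem card_filter_disjoint {Λ lam : ℕ} (T : Finset (Fin Λ)) :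
    #{U ∈ powersetCard lam (univ : Finset (Fin Λ)) | Disjoint T U} = (Λ - #T).choose lam := by
  have : {U ∈ powersetCard lam (univ : Finset (Fin Λ)) | Disjoint T U} = powersetCard lam Tᶜ := by
    ext U
    rw [mem_filter, mem_powersetCard, mem_powersetCard, subset_compl_iff_disjoint_left]
    simp [and_comm]
  rw [this, card_powersetCard, card_compl, Fintype.card_fin]

theorem choose_le_card_ensemble {Λ K lam : ℕ} (hK : 0 < K) :
    Λ.choose lam ≤ #(ensemble Λ K lam) := by
  have h := card_le_card_of_injOn (s := powersetCard lam (univ : Finset (Fin Λ)))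
    (t := ensemble Λ K lam) (fun U => Pi.single U K)
    (fun U hU => mem_coe.2 (single_mem_ensemble (mem_powersetCard.1 hU).2))
    (fun U _ V _ h => by
      by_contra hne
      have h1 := congrFun h U
      simp only [Pi.single_eq_same, Pi.single_eq_of_ne hne] at h1
      omega)
  simpa using h

theorem card_ensemble_pos {Λ K lam : ℕ} (h : lam ≤ Λ) : 0 < #(ensemble Λ K lam) := by
  obtain ⟨U, hU⟩ := powersetCard_nonempty.2
    (show lam ≤ #(univ : Finset (Fin Λ)) by simpa using h)
  exact card_pos.2 ⟨_, single_mem_ensemble (mem_powersetCard.1 hU).2⟩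

/-- The load of a corner point, with the two contributions collected. -/
theorem cornerPoint_snd {Λ N K lam : ℕ} (hlam : 1 ≤ lam) (h : lam ≤ Λ) (t : ℕ) :
    (cornerPoint Λ N K lam t).2 = (K : ℝ) / #(ensemble Λ K lam) *
      (((Λ - t).choose lam : ℝ) * (1 + (#(ensemble Λ K lam) / (Λ.choose lam : ℝ) - 1) *
        (1 / ((t + lam).choose lam : ℝ)))) := by
  have hE : (#(ensemble Λ K lam) : ℝ) ≠ 0 := by exact_mod_cast (card_ensemble_pos h).ne'
  have hm : (Λ.choose lam : ℝ) ≠ 0 := by exact_mod_cast (Nat.choose_pos h).ne'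
  have hc : ((t + lam).choose lam : ℝ) ≠ 0 := by
    exact_mod_cast (Nat.choose_pos (Nat.le_add_left _ _)).ne'
  have hq : (Λ.choose (t + lam) : ℝ) / Λ.choose t =
      ((Λ - t).choose lam : ℝ) / ((t + lam).choose lam : ℝ) := by
    by_cases ht : t ≤ Λ
    · have ht' : (Λ.choose t : ℝ) ≠ 0 := by exact_mod_cast (Nat.choose_pos ht).ne'
      rw [div_eq_div_iff ht' hc]
      have h1 := Nat.choose_mul (n := Λ) (Nat.le_add_right t lam)
      rw [Nat.add_sub_cancel_left, Nat.choose_symm_add] at h1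
      rw [mul_comm ((Λ - t).choose lam : ℝ)]
      exact_mod_cast h1
    · rw [Nat.choose_eq_zero_of_lt (by omega : Λ < t + lam),
          Nat.choose_eq_zero_of_lt (by omega : Λ - t < lam)]
      simp
  simp only [cornerPoint, extraLoad]
  rw [mul_div_mul_comm, hq]
  field_simp
  ring

/-- The converse bound on the average load, in terms of the number of caches that hold each bit. -/
theorem sum_cornerPoint_le {Λ N K lam B : ℕ} (hlam : 1 ≤ lam) (hlamΛ : lam ≤ Λ) (hK : 0 < K)
    (hKN : K ≤ N) (Z : Placement Λ N B) (L : (Finset (Fin Λ) → ℕ) → ℕ)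
    (h : ∀ b ∈ ensemble Λ K lam, ∀ d : User b → Fin N, Serves Z b (L b) d) :
    #(ensemble Λ K lam) * ∑ p : Fin N × Fin B, (cornerPoint Λ N K lam #(holders Z p)).2 ≤
      N * ∑ b ∈ ensemble Λ K lam, (L b : ℝ) := by
  classical
  set E := ensemble Λ K lam with hEdef
  set P := powersetCard lam (univ : Finset (Fin Λ)) with hP
  have hE : (#E : ℝ) ≠ 0 := by exact_mod_cast (card_ensemble_pos hlamΛ).ne'
  have hm : (Λ.choose lam : ℝ) ≠ 0 := by exact_mod_cast (Nat.choose_pos hlamΛ).ne'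
  let g : (Finset (Fin Λ) → ℕ) → ℝ := fun b => ∑ p : Fin N × Fin B, ∑ U ∈ P,
    (if Disjoint (holders Z p) U then
      (b U : ℝ) / ((#(holders Z p) + lam).choose lam : ℝ) else 0)
  have hPc : ∀ U ∈ P, #U = lam := fun U hU => (mem_powersetCard.1 hU).2
  have hg : ∀ b ∈ E, 0 ≤ N * (L b : ℝ) - g b := by
    intro b hb
    obtain ⟨h1, h2⟩ := mem_ensemble.1 hb
    have h3 := sum_div_choose_le (h1.trans_le hKN) (h b hb)
    refine sub_nonneg.2 (le_trans (sum_le_sum fun p _ => ?_) h3)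
    rw [← sum_subset (subset_univ P)]
    · exact sum_le_sum fun U hU => by rw [hPc U hU]
    · intro U _ hU
      have : b U = 0 := by
        by_contra hne
        exact hU (mem_powersetCard.2 ⟨subset_univ _, h2 U hne⟩)
      simp [this]
  have hsingle : ∀ U ∈ P, ∑ p : Fin N × Fin B, (if Disjoint (holders Z p) U then
      (K : ℝ) * (1 - 1 / ((#(holders Z p) + lam).choose lam : ℝ)) else 0) ≤
      N * (L (Pi.single U K) : ℝ) - g (Pi.single U K) := by
    intro U hU
    have h1 := sum_le_of_concentrated U hKN (h _ (single_mem_ensemble (hPc U hU)))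
    refine le_trans (le_of_eq ?_) (sub_le_sub_right h1 _)
    rw [← sum_sub_distrib]
    refine sum_congr rfl fun p _ => ?_
    rw [sum_eq_single_of_mem U hU]
    · split_ifs
      · rw [Pi.single_eq_same]; ring
      · ring
    · intro V _ hV
      simp [Pi.single_eq_of_ne hV]
  have hinj : Set.InjOn (fun U => (Pi.single U K : Finset (Fin Λ) → ℕ))
      (P : Set (Finset (Fin Λ))) := by
    intro U _ V _ h
    by_contra hne
    have h1 := congrFun h U
    simp only [Pi.single_eq_same, Pi.single_eq_of_ne hne] at h1
    omega
  have hsub : P.image (fun U => (Pi.single U K : Finset (Fin Λ) → ℕ)) ⊆ E := by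
    intro b hb
    obtain ⟨U, hU, rfl⟩ := mem_image.1 hb
    exact single_mem_ensemble (hPc U hU)
  -- The slack in the generic bound is nonnegative everywhere; only that of the concentrated
  -- connectivities is kept.
  have h1 := sum_le_sum_of_subset_of_nonneg hsub fun b hb _ => hg b hb
  rw [sum_image hinj] at h1
  have h2 := (sum_le_sum hsingle).trans h1
  rw [sum_sub_distrib, ← mul_sum] at h2
  rw [le_sub_iff_add_le] at h2
  refine le_trans (le_of_eq ?_) h2
  have hgsum : ∑ b ∈ E, g b = ∑ p : Fin N × Fin B, ∑ U ∈ P,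
      (if Disjoint (holders Z p) U then (K * #E / Λ.choose lam : ℝ) /
        ((#(holders Z p) + lam).choose lam : ℝ) else 0) := by
    simp only [g]
    rw [sum_comm]
    refine sum_congr rfl fun p _ => ?_
    rw [sum_comm]
    refine sum_congr rfl fun U hU => ?_
    split_ifs
    · rw [← sum_div]
      congr 1
      rw [eq_div_iff hm, mul_comm]
      exact_mod_cast sum_ensemble_apply (hPc U hU)
    · simp
  rw [hgsum, sum_comm, ← sum_add_distrib, mul_sum]
  refine sum_congr rfl fun p _ => ?_
  rw [← sum_filter, ← sum_filter, sum_const, sum_const, card_filter_disjoint,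
    cornerPoint_snd hlam hlamΛ, nsmul_eq_mul, nsmul_eq_mul]
  have hc : ((#(holders Z p) + lam).choose lam : ℝ) ≠ 0 := by
    exact_mod_cast (Nat.choose_pos (Nat.le_add_left _ _)).ne'
  rw [← hEdef]
  field_simp
  ring

/-! ### Convexity of the corner loads. -/

/-- A sequence that is nonnegative, nonincreasing and convex. -/
structure ConvexDecay (f : ℕ → ℝ) : Prop where
  nonneg : ∀ t, 0 ≤ f t
  anti : ∀ t, f (t + 1) ≤ f t
  convex : ∀ t, f (t + 1) - f (t + 2) ≤ f t - f (t + 1)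

/-- The decrement of `f * g` at `t` is `(f t - f (t + 1)) * g t + f (t + 1) * (g t - g (t + 1))`,
with all factors nonnegative and nonincreasing. -/
theorem ConvexDecay.mul {f g : ℕ → ℝ} (hf : ConvexDecay f) (hg : ConvexDecay g) :
    ConvexDecay fun t => f t * g t where
  nonneg t := mul_nonneg (hf.nonneg t) (hg.nonneg t)
  anti t := mul_le_mul (hf.anti t) (hg.anti t) (hg.nonneg _) (hf.nonneg _)
  convex t := by
    have h1 := mul_le_mul (hf.convex t) (hg.anti t) (hg.nonneg _) (sub_nonneg.2 (hf.anti t))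
    have h2 := mul_le_mul (hf.anti (t + 1)) (hg.convex t) (sub_nonneg.2 (hg.anti (t + 1)))
      (hf.nonneg _)
    have e : t + 1 + 1 = t + 2 := rfl
    simp only [e] at h1 h2
    linarith

theorem ConvexDecay.const_mul {f : ℕ → ℝ} (hf : ConvexDecay f) {c : ℝ} (hc : 0 ≤ c) :
    ConvexDecay fun t => c * f t :=
  ConvexDecay.mul ⟨fun _ => hc, fun _ => le_rfl, fun _ => by simp⟩ hf

theorem ConvexDecay.const_add {f : ℕ → ℝ} (hf : ConvexDecay f) {c : ℝ} (hc : 0 ≤ c) :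
    ConvexDecay fun t => c + f t where
  nonneg t := add_nonneg hc (hf.nonneg t)
  anti t := by linarith [hf.anti t]
  convex t := by linarith [hf.convex t]

/-- A convex sequence lies above the line through two consecutive points. -/
theorem ConvexDecay.line_le {f : ℕ → ℝ} (hf : ConvexDecay f) (s t : ℕ) :
    f s + ((t : ℝ) - s) * (f (s + 1) - f s) ≤ f t := by
  have hanti : Antitone fun t => f t - f (t + 1) := antitone_nat_of_succ_le hf.convex
  obtain h | h := le_total s t
  · induction t, h using Nat.le_induction with
    | base => simp
    | succ t h ih => have := hanti h; push_cast; simp only at this; linarith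
  · induction h using Nat.decreasingInduction with
    | self => simp
    | of_succ t h ih => have := hanti h.le; push_cast at ih; simp only at this; linarith

theorem convexDecay_choose_sub {lam : ℕ} (hlam : 1 ≤ lam) (Λ : ℕ) :
    ConvexDecay fun t => ((Λ - t).choose lam : ℝ) where
  nonneg t := Nat.cast_nonneg _
  anti t := by exact_mod_cast Nat.choose_le_choose lam (by omega : Λ - (t + 1) ≤ Λ - t)
  convex t := by
    obtain ⟨l, rfl⟩ : ∃ l, lam = l + 1 := ⟨lam - 1, by omega⟩
    -- Past `Λ` the truncated subtraction gives `choose 0 lam = 0`, since `lam` is positive; before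
    -- that, Pascal's rule turns decrements into binomials.
    obtain h | h : Λ < t + 2 ∨ t + 2 ≤ Λ := by omega
    · have h1 : (Λ - (t + 2)).choose (l + 1) = 0 := by
        rw [show Λ - (t + 2) = 0 by omega, Nat.choose_zero_succ]
      simp only [h1, show Λ - (t + 1) = 0 by omega, Nat.choose_zero_succ]
      simp
    · obtain ⟨n, rfl⟩ := Nat.exists_eq_add_of_le h
      rw [show t + 2 + n - (t + 2) = n by omega, show t + 2 + n - (t + 1) = n + 1 by omega,
        show t + 2 + n - t = n + 2 by omega, Nat.choose_succ_succ (n + 1), Nat.choose_succ_succ n]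
      have : (n.choose l : ℝ) ≤ (n + 1).choose l := by
        exact_mod_cast Nat.choose_le_choose l (Nat.le_succ n)
      push_cast [Nat.succ_eq_add_one] at this ⊢
      linarith

theorem convexDecay_one_div_choose (lam : ℕ) :
    ConvexDecay fun t => 1 / ((t + lam).choose lam : ℝ) := by
  have hpos : ∀ t, (0 : ℝ) < 1 / ((t + lam).choose lam : ℝ) := fun t =>
    one_div_pos.2 (by exact_mod_cast Nat.choose_pos (Nat.le_add_left _ _))
  -- The decrement is a product of two nonincreasing nonnegative factors, which gives convexity.
  have hrec : ∀ t : ℕ, 1 / ((t + lam).choose lam : ℝ) - 1 / ((t + 1 + lam).choose lam : ℝ) =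
      1 / ((t + lam).choose lam : ℝ) * (lam / (t + 1 + lam : ℝ)) := by
    intro t
    have h1 : ((t + lam).choose lam : ℝ) ≠ 0 := by
      exact_mod_cast (Nat.choose_pos (Nat.le_add_left _ _)).ne'
    have h2 : ((t + 1 + lam).choose lam : ℝ) ≠ 0 := by
      exact_mod_cast (Nat.choose_pos (Nat.le_add_left _ _)).ne'
    have h3 : ((t + 1 + lam).choose lam : ℝ) * (t + 1) =
        ((t + lam).choose lam : ℝ) * (t + 1 + lam) := by
      have := Nat.choose_mul_succ_eq (t + lam) lam
      rw [show t + lam + 1 - lam = t + 1 by omega, show t + lam + 1 = t + 1 + lam by omega] at this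
      exact_mod_cast this.symm
    have h4 : (t + 1 + lam : ℝ) ≠ 0 := by positivity
    field_simp
    linear_combination h3
  have hanti : ∀ t : ℕ, 1 / ((t + 1 + lam).choose lam : ℝ) ≤ 1 / ((t + lam).choose lam : ℝ) := by
    intro t
    rw [← sub_nonneg, hrec]
    exact mul_nonneg (hpos t).le (by positivity)
  refine ⟨fun t => (hpos t).le, hanti, fun t => ?_⟩
  have e : t + 2 + lam = t + 1 + 1 + lam := rfl
  simp only [e]
  rw [hrec, hrec]
  refine mul_le_mul (hanti t) ?_ (by positivity) (hpos t).le
  push_cast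
  gcongr
  linarith

theorem convexDecay_cornerPoint {Λ K lam : ℕ} (N : ℕ) (hlam : 1 ≤ lam) (h : lam ≤ Λ)
    (hK : 0 < K) : ConvexDecay fun t => (cornerPoint Λ N K lam t).2 := by
  simp only [cornerPoint_snd hlam h]
  refine .const_mul (.mul (convexDecay_choose_sub hlam Λ) (.const_add
    (.const_mul (convexDecay_one_div_choose lam) ?_) zero_le_one)) (by positivity)
  -- The ensemble contains one concentrated connectivity per `lam`-set, so the coefficient is
  -- nonnegative.
  rw [sub_nonneg, one_le_div (by exact_mod_cast Nat.choose_pos h)]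
  exact_mod_cast choose_le_card_ensemble hK

/-! ### The memory constraint and the conclusion. -/

theorem sum_card_holders {Λ N B : ℕ} (Z : Placement Λ N B) :
    ∑ p, #(holders Z p) = ∑ ℓ, #(Z ℓ) := by
  simp only [holders, card_filter]
  rw [sum_comm]
  simp

end MACC

theorem theorem2 (Λ N K lam : ℕ) (hlam : 1 ≤ lam) (hlamΛ : lam ≤ Λ) (hKN : K ≤ N) :
    (MACC.ensemble Λ K lam).card = (K + Λ.choose lam - 1).choose K ∧
    ∀ M R : ℝ, (M, R) ∈ MACC.lowerBoundCurve Λ N K lam →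
      R ≤ MACC.optAvgLoad Λ N K lam M := by
  refine ⟨MACC.card_ensemble Λ K lam, ?_⟩
  rintro M R ⟨t, -, x, y, hx, hy, hxy, hp⟩
  obtain ⟨hM, hR⟩ := Prod.mk.inj hp
  simp only [Prod.smul_fst, Prod.smul_snd, smul_eq_mul] at hM hR
  have hM0 : 0 ≤ M := by
    rw [← hM]
    simp only [MACC.cornerPoint]
    positivity
  refine le_csInf (MACC.achievable_nonempty Λ N K lam hM0) ?_
  rintro R' ⟨B, hB, Z, L, hZ, hL, hR'⟩
  refine le_trans ?_ hR'
  have hEpos : (0 : ℝ) < ((MACC.ensemble Λ K lam).card : ℝ) := by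
    exact_mod_cast MACC.card_ensemble_pos hlamΛ
  -- Without users the curve is zero; the ensemble is then a single point and the convexity argument
  -- is unavailable.
  obtain rfl | hK := Nat.eq_zero_or_pos K
  · have hzero : ∀ s, (MACC.cornerPoint Λ N 0 lam s).2 = 0 := fun s => by
      simp [MACC.cornerPoint, MACC.extraLoad]
    rw [hzero, hzero, mul_zero, mul_zero, add_zero] at hR
    rw [← hR]
    positivity
  have hN : (0 : ℝ) < N := by exact_mod_cast hK.trans_le hKN
  have hΛ : (0 : ℝ) < Λ := by exact_mod_cast (by omega : 0 < Λ)
  have hBpos : (0 : ℝ) < B := by exact_mod_cast hB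
  have hmain := MACC.sum_cornerPoint_le hlam hlamΛ hK hKN Z L hL
  have hconv := MACC.convexDecay_cornerPoint N hlam hlamΛ hK
  set c : ℕ → ℝ := fun s => (MACC.cornerPoint Λ N K lam s).2 with hc
  have hline := Finset.sum_le_sum fun (p : Fin N × Fin B) (_ : p ∈ Finset.univ) =>
    hconv.line_le t (MACC.holders Z p).card
  rw [Finset.sum_add_distrib, ← Finset.sum_mul, Finset.sum_sub_distrib] at hline
  simp only [Finset.sum_const, Finset.card_univ, Fintype.card_prod, Fintype.card_fin,
    nsmul_eq_mul, Nat.cast_mul] at hline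
  have hmem : ∑ p, ((MACC.holders Z p).card : ℝ) ≤ Λ * (M * B) := by
    have h1 : ∑ ℓ, ((Z ℓ).card : ℝ) ≤ ∑ _ℓ : Fin Λ, M * B := Finset.sum_le_sum fun ℓ _ => hZ ℓ
    rw [Finset.sum_const, Finset.card_univ, Fintype.card_fin, nsmul_eq_mul] at h1
    exact le_of_eq_of_le (by exact_mod_cast MACC.sum_card_holders Z) h1
  -- In units of `N / Λ`, the memory is `t + y`.
  have hMt : (Λ : ℝ) * M = N * (t + y) := by
    rw [← hM]
    simp only [MACC.cornerPoint]
    have hx' : x = 1 - y := by linarith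
    subst hx'
    push_cast
    field_simp
    ring
  have hRt : R = c t + y * (c (t + 1) - c t) := by
    have hx' : x = 1 - y := by linarith
    rw [← hR, hx']
    simp only [hc]
    ring
  have hslope : c (t + 1) - c t ≤ 0 := sub_nonpos.2 (hconv.anti t)
  have hsum : N * B * R ≤ ∑ p, c (MACC.holders Z p).card := by
    refine le_trans ?_ hline
    have h1 : ∑ p, ((MACC.holders Z p).card : ℝ) - N * B * t ≤ N * B * y := by
      have : (Λ : ℝ) * (M * B) = N * (t + y) * B := by rw [← mul_assoc, hMt]
      linarith
    -- The slope is nonpositive, so an upper bound on the total number of holders bounds the load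
    -- from below.
    have h2 := mul_le_mul_of_nonpos_right h1 hslope
    rw [hRt]
    linarith
  have hfin := (mul_le_mul_of_nonneg_left hsum hEpos.le).trans hmain
  rw [le_div_iff₀ hEpos, ← Finset.sum_div, le_div_iff₀ hBpos]
  refine le_of_mul_le_mul_left ?_ hN
  linarith
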